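/- Let $T>0$, $0<q<r<qe$, $\Omega=(-1,1)$, $\alpha=(r-q-1)/2$, $\beta=\alpha^2+r$, $\varphi(x)=e^{\alpha x}\max(e^x-1,0)$ and $x_0=\log(r/q)\in(0,1)$. Let $\zeta:\mathbb R\to\mathbb R$ be smooth with $\zeta'\ge 0$ and $\zeta''\le 0$ on $\mathbb R$, $\zeta=0$ on $[0,\infty)$ and $\zeta\not\equiv 0$, and put $\zeta_\varepsilon(s)=\zeta(s/\varepsilon)$ for $\varepsilon>0$. For $h>0$ and $\varepsilon>0$ let $u_0^\varepsilon=\varphi$ and, for $m=1,\dots,\lfloor T/h\rfloor$, let $u_m^\varepsilon\in C(\overline\Omega)\cap H^1(\Omega)$ be the weak solution of $$\frac{u_m^\varepsilon-u_{m-1}^\varepsilon}{h}-(u_m^\varepsilon)_{xx}+\beta u_m^\varepsilon+\zeta_\varepsilon(u_m^\varepsilon-\varphi)=0\ \text{ in }\Omega,\qquad u_m^\varepsilon(\pm1)=\varphi(\pm1),$$ that is, $u_m^\varepsilon-\varphi\in H_0^1(\Omega)$ and $$\int_\Omega\Big\{\frac{u_m^\varepsilon-u_{m-1}^\varepsilon}{h}\,\phi+(u_m^\varepsilon)_x\phi_x+\beta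 u_m^\varepsilon\phi+\zeta_\varepsilon(u_m^\varepsilon-\varphi)\phi\Big\}\,dx=0\quad\text{for all }\phi\in H_0^1(\Omega).$$ Then there exists $h_2>0$ (depending only on $r$, $q$, $T$ and $\zeta$) such that for all $h\in(0,h_2)$, all $\varepsilon\in(0,h^4)$ and all $m=1,2,\dots,\lfloor T/h\rfloor$, one has $(-1,x_0+\sqrt h/2)\subset\Omega$ and $$u_m^\varepsilon>\varphi\quad\text{in }(-1,x_0+\sqrt h/2).$$ -/

import Mathlib

open MeasureTheory Set Filter Topology
open scoped ContDiff

noncomputable section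

namespace DMS

/-- The domain `Ω = (-1, 1)`. -/
def Omega : Set ℝ := Ioo (-1) 1

/-- Lebesgue measure on `Ω`. -/
def muOmega : Measure ℝ := volume.restrict Omega

/-- Elements of `C_c^∞(Ω)`, extended by zero to the real line. -/
structure IsTest (ψ : ℝ → ℝ) : Prop where
  smooth : ContDiff ℝ ∞ ψ
  compact : HasCompactSupport ψ
  supp : tsupport ψ ⊆ Omega

/-- `v ∈ H¹(Ω)` and `g ∈ L²(Ω)` is its weak derivative. -/
structure HasWeakDeriv (v g : ℝ → ℝ) : Prop where
  memLp : MemLp v 2 muOmega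
  memLp_deriv : MemLp g 2 muOmega
  weak : ∀ ψ : ℝ → ℝ, IsTest ψ →
    ∫ x, v x * deriv ψ x ∂muOmega = - ∫ x, g x * ψ x ∂muOmega

/-- `v ∈ H₀¹(Ω)`, the closure of `C_c^∞(Ω)` in `H¹(Ω)`. -/
def MemH10 (v : ℝ → ℝ) : Prop :=
  ∃ g : ℝ → ℝ, HasWeakDeriv v g ∧ ∃ ψ : ℕ → ℝ → ℝ, (∀ n, IsTest (ψ n)) ∧
    Tendsto (fun n => eLpNorm (fun x => ψ n x - v x) 2 muOmega) atTop (𝓝 0) ∧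
    Tendsto (fun n => eLpNorm (fun x => deriv (ψ n) x - g x) 2 muOmega) atTop (𝓝 0)

/-- `α = (r - q - 1) / 2`. -/
def alpha (r q : ℝ) : ℝ := (r - q - 1) / 2

/-- `β = α² + r`. -/
def beta (r q : ℝ) : ℝ := alpha r q ^ 2 + r

/-- The obstacle `φ(x) = e^{αx} max(e^x - 1, 0)`. -/
def obstacle (r q : ℝ) (x : ℝ) : ℝ :=
  Real.exp (alpha r q * x) * max (Real.exp x - 1) 0

/-- Penalty functions: smooth, nondecreasing, concave, zero on `[0, ∞)` and not identically zero
(so that, by concavity, `ζ s → -∞` as `s → -∞`). -/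
structure IsPenalty (ζ : ℝ → ℝ) : Prop where
  smooth : ContDiff ℝ ∞ ζ
  deriv_nonneg : ∀ s, 0 ≤ deriv ζ s
  deriv_deriv_nonpos : ∀ s, deriv (deriv ζ) s ≤ 0
  eq_zero : ∀ s, 0 ≤ s → ζ s = 0
  exists_neg : ∃ s, ζ s < 0

/-- `u` is (the continuous representative of) a weak solution of
`(u - w)/h - u'' + β u + ζ((u - φ)/ε) = 0` in `Ω`, `u(±1) = φ(±1)`. -/
structure IsWeakStep (r q h ε : ℝ) (ζ w u : ℝ → ℝ) : Prop where
  continuousOn : ContinuousOn u (Icc (-1) 1)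
  boundary : MemH10 (fun x => u x - obstacle r q x)
  weak : ∃ du : ℝ → ℝ, HasWeakDeriv u du ∧
    ∀ v dv : ℝ → ℝ, MemH10 v → HasWeakDeriv v dv →
      ∫ x, ((u x - w x) / h * v x + du x * dv x + beta r q * u x * v x
        + ζ ((u x - obstacle r q x) / ε) * v x) ∂muOmega = 0

/-- `u 0, …, u ⌊T/h⌋` are the iterates of the penalized discrete Morse semiflow
with time step `h` and penalization parameter `ε`. -/
structure IsPenalizedDMS (r q T h ε : ℝ) (ζ : ℝ → ℝ) (u : ℕ → ℝ → ℝ) : Prop where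
  init : EqOn (u 0) (obstacle r q) (Icc (-1) 1)
  step : ∀ m : ℕ, 1 ≤ m → m ≤ ⌊T / h⌋₊ → IsWeakStep r q h ε ζ (u (m - 1)) (u m)

end DMS

end

/-!
Write `L = -∂ₓₓ + β`, `x₀ = log (r / q)`, and `w = u - φ` for the excess of a step over the obstacle.
On `(0, 1)` one has `-Lφ = e^{αx} (r - q eˣ)`, which changes sign exactly at `x₀`, while on `(-1, 0)`
the obstacle vanishes and at `0` it has a convex kink. So `φ` is a subsolution to the left of `x₀`,
and one implicit Euler step lifts the solution above `φ` on a further stretch of order `√h`: with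
`x = x₀ + √h y`, the rescaled problem `W - W'' = -c y` has the solution `W = c (e^y / 3 - y)`, which
is positive for `y ≤ 1/2` and negative at `y = 1`.

Two bounds pass from each step to the next. `IsWeakStep.obstacle_sub_le` gives `w ≥ -K ε` on
`[-1, 1]`, where `K` is such that `-ζ (-K)` dominates `Lφ`. `IsWeakStep.obstacle_add_le`, applied to
the barrier of `exists_barrier` on `[-1, x₀ + √h]`, gives `w > 0` on `(-1, x₀ + √h / 2]`; the
violation `K ε ≤ K h⁴` of the obstacle is negligible against the size `h^{3/2}` of the barrier. The
step preceding enters only through these two bounds, so the argument is uniform in the number of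
steps.

Both comparisons are made pointwise. By the du Bois-Reymond lemma a weak step is a classical solution
in the interior (`IsWeakStep.exists_hasDerivAt`), and its continuous representative attains the
boundary values (`MemH10.eq_zero_of_continuousOn`). The obstacle and the barrier are maxima of smooth
functions, so at a minimum of `u - s` the second derivative test applies to a smooth function touching
`s` from below (`le_of_hasLowerContact`).
-/

namespace DMS

/-! ### Test functions -/

instance : IsFiniteMeasure muOmega := by
  unfold muOmega Omega
  infer_instance

theorem integral_muOmega (f : ℝ → ℝ) : ∫ x, f x ∂muOmega = ∫ x in (-1 : ℝ)..1, f x := by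
  rw [intervalIntegral.integral_of_le (by norm_num), integral_Ioc_eq_integral_Ioo]
  rfl

theorem integrable_muOmega_of_continuousOn {f : ℝ → ℝ} (hf : ContinuousOn f (Icc (-1) 1)) :
    Integrable f muOmega :=
  (hf.integrableOn_compact isCompact_Icc).mono_set Ioo_subset_Icc_self

theorem IsTest.eq_zero {ψ : ℝ → ℝ} (hψ : IsTest ψ) {x : ℝ} (hx : x ∉ Omega) : ψ x = 0 :=
  image_eq_zero_of_notMem_tsupport fun h => hx (hψ.supp h)

theorem IsTest.continuous_deriv {ψ : ℝ → ℝ} (hψ : IsTest ψ) : Continuous (deriv ψ) :=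
  hψ.smooth.continuous_deriv (by simp)

theorem IsTest.hasDerivAt {ψ : ℝ → ℝ} (hψ : IsTest ψ) (x : ℝ) : HasDerivAt ψ (deriv ψ x) x :=
  (hψ.smooth.differentiable (by simp) x).hasDerivAt

theorem IsTest.exists_eq_zero {ψ : ℝ → ℝ} (hψ : IsTest ψ) :
    ∃ a b : ℝ, -1 < a ∧ b < 1 ∧ (∀ x < a, ψ x = 0) ∧ ∀ x > b, ψ x = 0 := by
  have hc : IsCompact (tsupport ψ) := hψ.compact
  rcases (tsupport ψ).eq_empty_or_nonempty with he | hne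
  · refine ⟨0, 0, by norm_num, by norm_num, fun x _ => ?_, fun x _ => ?_⟩ <;>
      exact image_eq_zero_of_notMem_tsupport (by simp [he])
  · obtain ⟨a, ha⟩ := hc.exists_isLeast hne
    obtain ⟨b, hb⟩ := hc.exists_isGreatest hne
    refine ⟨a, b, (hψ.supp ha.1).1, (hψ.supp hb.1).2, fun x hx => ?_, fun x hx => ?_⟩
    · exact image_eq_zero_of_notMem_tsupport fun h => absurd (ha.2 h) (not_le.2 hx)
    · exact image_eq_zero_of_notMem_tsupport fun h => absurd (hb.2 h) (not_le.2 hx)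

theorem isTest_of_eq_zero {ψ : ℝ → ℝ} (hψ : ContDiff ℝ ∞ ψ) {a b : ℝ} (ha : -1 < a) (hb : b < 1)
    (h1 : ∀ x < a, ψ x = 0) (h2 : ∀ x > b, ψ x = 0) : IsTest ψ := by
  have hsub : tsupport ψ ⊆ Icc a b := by
    refine closure_minimal (fun x hx => ?_) isClosed_Icc
    refine ⟨?_, ?_⟩ <;> by_contra! hlt
    · exact hx (h1 x hlt)
    · exact hx (h2 x hlt)
  exact ⟨hψ, isCompact_Icc.of_isClosed_subset (isClosed_tsupport ψ) hsub,
    fun x hx => ⟨ha.trans_le (hsub hx).1, (hsub hx).2.trans_lt hb⟩⟩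

/-- A test function of mean zero is the derivative of a test function. -/
theorem IsTest.exists_deriv_eq {η : ℝ → ℝ} (hη : IsTest η) (h0 : ∫ x, η x ∂muOmega = 0) :
    ∃ ψ, IsTest ψ ∧ deriv ψ = η := by
  obtain ⟨a, b, ha, hb, h1, h2⟩ := hη.exists_eq_zero
  have hc := hη.smooth.continuous
  have hd : ∀ x, HasDerivAt (fun y => ∫ t in (-1 : ℝ)..y, η t) (η x) x := fun x =>
    hc.integral_hasStrictDerivAt _ x |>.hasDerivAt
  have hd' : deriv (fun y => ∫ t in (-1 : ℝ)..y, η t) = η := funext fun x => (hd x).deriv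
  refine ⟨_, isTest_of_eq_zero ?_ ha hb ?_ ?_, hd'⟩
  · exact contDiff_infty_iff_deriv.2 ⟨fun x => (hd x).differentiableAt, hd'.symm ▸ hη.smooth⟩
  · intro x hx
    rw [intervalIntegral.integral_congr (g := fun _ => (0 : ℝ)) fun t ht => ?_]
    · simp
    · exact h1 t (ht.2.trans_lt (max_lt ha hx))
  · intro x hx
    rw [← intervalIntegral.integral_add_adjacent_intervals (b := 1)
      (hc.intervalIntegrable _ _) (hc.intervalIntegrable _ _), ← integral_muOmega, h0, zero_add,
      intervalIntegral.integral_congr (g := fun _ => (0 : ℝ)) fun t ht => ?_]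
    · simp
    · exact h2 t (lt_of_lt_of_le (lt_min hb hx) ht.1)

theorem exists_isTest_integral_eq_one : ∃ η, IsTest η ∧ ∫ x, η x ∂muOmega = 1 := by
  obtain ⟨f, hf, hfc, hfs, hfr, hf0⟩ := exists_contDiff_tsupport_subset (n := ⊤) (s := Omega)
    (x := (0 : ℝ)) (Ioo_mem_nhds (by norm_num) (by norm_num))
  have hpos : 0 < ∫ x, f x ∂muOmega := by
    rw [muOmega, setIntegral_eq_integral_of_forall_compl_eq_zero fun x hx =>
      image_eq_zero_of_notMem_tsupport fun h => hx (hf h)]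
    exact hfs.continuous.integral_pos_of_hasCompactSupport_nonneg_nonzero hfc
      (fun x => (hfr ⟨x, rfl⟩).1) (x := 0) (by simp [hf0])
  refine ⟨fun x => (∫ x, f x ∂muOmega)⁻¹ * f x, ⟨contDiff_const.mul hfs, hfc.mul_left, ?_⟩, ?_⟩
  · exact (closure_mono (Function.support_mul_subset_right _ _)).trans hf
  · rw [integral_const_mul, inv_mul_cancel₀ hpos.ne']

theorem IsTest.add_const_mul {ψ η : ℝ → ℝ} (hψ : IsTest ψ) (hη : IsTest η) (c : ℝ) :
    IsTest fun x => ψ x + c * η x := by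
  obtain ⟨a, b, ha, hb, h1, h2⟩ := hψ.exists_eq_zero
  obtain ⟨a', b', ha', hb', h1', h2'⟩ := hη.exists_eq_zero
  refine isTest_of_eq_zero (hψ.smooth.add (contDiff_const.mul hη.smooth)) (lt_min ha ha')
    (max_lt hb hb') (fun x hx => ?_) fun x hx => ?_
  · simp [h1 x (hx.trans_le (min_le_left _ _)), h1' x (hx.trans_le (min_le_right _ _))]
  · simp [h2 x ((le_max_left _ _).trans_lt hx), h2' x ((le_max_right _ _).trans_lt hx)]

theorem integrable_mul_muOmega {g η : ℝ → ℝ} (hg : Integrable g muOmega)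
    (hη : Continuous η) : Integrable (fun x => g x * η x) muOmega :=
  IntegrableOn.mul_continuousOn_of_subset hg hη.continuousOn measurableSet_Ioo isCompact_Icc
    Ioo_subset_Icc_self

/-! ### The du Bois-Reymond lemma and regularity of weak steps -/

/-- The du Bois-Reymond lemma: a function with vanishing weak derivative is constant. -/
theorem exists_ae_eq_const {g : ℝ → ℝ} (hg : Integrable g muOmega)
    (h : ∀ ψ, IsTest ψ → ∫ x, g x * deriv ψ x ∂muOmega = 0) :
    ∃ c : ℝ, ∀ᵐ x ∂muOmega, g x = c := by
  obtain ⟨η₀, hη₀, h1⟩ := exists_isTest_integral_eq_one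
  refine ⟨∫ x, g x * η₀ x ∂muOmega, ?_⟩
  set c := ∫ x, g x * η₀ x ∂muOmega with hc
  have hint : Integrable (fun x => g x - c) muOmega := hg.sub (integrable_const c)
  have key := isOpen_Ioo.ae_eq_zero_of_integral_contDiff_smul_eq_zero (U := Omega) (μ := volume)
    (f := fun x => g x - c) (IntegrableOn.locallyIntegrableOn hint) ?_
  · have := (ae_restrict_iff' (μ := volume) (s := Omega) measurableSet_Ioo).2 key
    filter_upwards [this] with x hx
    linarith
  · intro η h1η h2η h3η
    have hη : IsTest η := ⟨h1η, h2η, h3η⟩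
    have hint' (η : ℝ → ℝ) (hη : IsTest η) : Integrable η muOmega :=
      integrable_muOmega_of_continuousOn hη.smooth.continuous.continuousOn
    obtain ⟨ψ, hψ, hψ'⟩ := (hη.add_const_mul hη₀ (-∫ x, η x ∂muOmega)).exists_deriv_eq (by
      rw [integral_add (hint' _ hη) ((hint' _ hη₀).const_mul _), integral_const_mul, h1]
      ring)
    have h2 := h ψ hψ
    have i1 := integrable_mul_muOmega hg hη.smooth.continuous
    have i2 := integrable_mul_muOmega hg hη₀.smooth.continuous
    have e : ∀ x, g x * deriv ψ x
        = g x * η x - (∫ x, η x ∂muOmega) * (g x * η₀ x) := fun x => by rw [hψ']; ring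
    simp only [e] at h2
    rw [integral_sub i1 (i2.const_mul _), integral_const_mul, ← hc] at h2
    rw [← setIntegral_eq_integral_of_forall_compl_eq_zero (s := Omega) fun x hx => by
      simp [hη.eq_zero hx]]
    change ∫ x, η x • (g x - c) ∂muOmega = 0
    have e' : ∀ x, η x • (g x - c) = g x * η x - c * η x := fun x => by
      rw [smul_eq_mul]; ring
    simp only [e']
    rw [integral_sub i1 ((hint' _ hη).const_mul _), integral_const_mul]
    linarith

theorem IsTest.integral_mul_deriv {ψ F f : ℝ → ℝ} (hψ : IsTest ψ)
    (hF : ∀ x, HasDerivAt F (f x) x) (hf : Continuous f) :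
    ∫ x, F x * deriv ψ x ∂muOmega = -∫ x, f x * ψ x ∂muOmega := by
  rw [integral_muOmega, integral_muOmega,
    intervalIntegral.integral_mul_deriv_eq_deriv_mul (fun x _ => hF x) (fun x _ => hψ.hasDerivAt x)
      (hf.intervalIntegrable _ _) (hψ.continuous_deriv.intervalIntegrable _ _),
    hψ.eq_zero (by simp [Omega]), hψ.eq_zero (by simp [Omega])]
  ring

/-- A function whose weak derivative is continuous is an antiderivative of it. -/
theorem exists_ae_eq_antideriv {g f : ℝ → ℝ} (hg : Integrable g muOmega) (hf : Continuous f)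
    (h : ∀ ψ, IsTest ψ → ∫ x, g x * deriv ψ x ∂muOmega = -∫ x, f x * ψ x ∂muOmega) :
    ∃ G : ℝ → ℝ, (∀ x, HasDerivAt G (f x) x) ∧ ∀ᵐ x ∂muOmega, g x = G x := by
  have hF : ∀ x, HasDerivAt (fun y => ∫ t in (-1 : ℝ)..y, f t) (f x) x := fun x =>
    hf.integral_hasStrictDerivAt _ x |>.hasDerivAt
  set F := fun y => ∫ t in (-1 : ℝ)..y, f t
  have hFc : Continuous F := continuous_iff_continuousAt.2 fun x => (hF x).continuousAt
  have hFi : Integrable F muOmega := integrable_muOmega_of_continuousOn hFc.continuousOn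
  obtain ⟨c, hc⟩ := exists_ae_eq_const (g := fun x => g x - F x) (hg.sub hFi) fun ψ hψ => by
    simp only [sub_mul]
    rw [integral_sub (integrable_mul_muOmega hg hψ.continuous_deriv)
      (integrable_mul_muOmega hFi hψ.continuous_deriv), h ψ hψ,
      hψ.integral_mul_deriv hF hf, sub_self]
  refine ⟨fun x => F x + c, fun x => (hF x).add_const c, ?_⟩
  filter_upwards [hc] with x hx
  linarith

theorem IsTest.hasWeakDeriv {ψ : ℝ → ℝ} (hψ : IsTest ψ) : HasWeakDeriv ψ (deriv ψ) := by
  have hm : ∀ f : ℝ → ℝ, Continuous f → MemLp f 2 muOmega := fun f hf =>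
    ((memLp_two_iff_integrable_sq_norm hf.aestronglyMeasurable).2
      (integrable_muOmega_of_continuousOn (by fun_prop)))
  exact ⟨hm _ hψ.smooth.continuous, hm _ hψ.continuous_deriv, fun η hη =>
    hη.integral_mul_deriv hψ.hasDerivAt hψ.continuous_deriv⟩

theorem IsTest.memH10 {ψ : ℝ → ℝ} (hψ : IsTest ψ) : MemH10 ψ :=
  ⟨deriv ψ, hψ.hasWeakDeriv, fun _ => ψ, fun _ => hψ, by simp, by simp⟩

theorem exists_continuous_eqOn {f : ℝ → ℝ} (hf : ContinuousOn f (Icc (-1) 1)) :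
    ∃ g : ℝ → ℝ, Continuous g ∧ EqOn g f (Icc (-1) 1) :=
  ⟨IccExtend (by norm_num : (-1 : ℝ) ≤ 1) ((Icc (-1) 1).domRestrict f), hf.domRestrict.Icc_extend',
    fun _ hx => IccExtend_of_mem _ _ hx⟩

theorem integral_muOmega_congr {f g : ℝ → ℝ} (h : EqOn f g Omega) :
    ∫ x, f x ∂muOmega = ∫ x, g x ∂muOmega :=
  setIntegral_congr_fun measurableSet_Ioo h

theorem ae_muOmega_of_forall {p : ℝ → Prop} (h : ∀ x ∈ Omega, p x) : ∀ᵐ x ∂muOmega, p x :=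
  (ae_restrict_iff' measurableSet_Ioo).2 (ae_of_all _ h)

theorem continuous_obstacle (r q : ℝ) : Continuous (obstacle r q) := by
  unfold obstacle
  fun_prop

/-- Interior regularity: a weak step with continuous data is a classical solution. -/
theorem IsWeakStep.exists_hasDerivAt {r q h ε : ℝ} {ζ w u : ℝ → ℝ}
    (hu : IsWeakStep r q h ε ζ w u) (hw : ContinuousOn w (Icc (-1) 1)) (hζ : Continuous ζ) :
    ∃ D : ℝ → ℝ, ∀ x ∈ Ioo (-1 : ℝ) 1, HasDerivAt u (D x) x ∧
      HasDerivAt D ((u x - w x) / h + beta r q * u x + ζ ((u x - obstacle r q x) / ε)) x := by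
  obtain ⟨du, hdu, hweak⟩ := hu.weak
  have huc := hu.continuousOn
  have hfc : ContinuousOn (fun x => (u x - w x) / h + beta r q * u x
      + ζ ((u x - obstacle r q x) / ε)) (Icc (-1) 1) := by
    refine ContinuousOn.add (((huc.sub hw).div_const _).add (continuousOn_const.mul huc)) ?_
    exact hζ.comp_continuousOn ((huc.sub (continuous_obstacle r q).continuousOn).div_const _)
  obtain ⟨f, hf, hfeq⟩ := exists_continuous_eqOn hfc
  have hdui : Integrable du muOmega := hdu.memLp_deriv.integrable (by norm_num)
  obtain ⟨D, hD, hDeq⟩ := exists_ae_eq_antideriv hdui hf fun ψ hψ => by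
    have h1 := hweak ψ _ hψ.memH10 hψ.hasWeakDeriv
    have h2 : ∀ x ∈ Omega, (u x - w x) / h * ψ x + du x * deriv ψ x + beta r q * u x * ψ x
        + ζ ((u x - obstacle r q x) / ε) * ψ x = du x * deriv ψ x + f x * ψ x := by
      intro x hx
      rw [hfeq (Ioo_subset_Icc_self hx)]
      ring
    rw [integral_muOmega_congr h2, integral_add
      (integrable_mul_muOmega hdui hψ.continuous_deriv)
      (g := fun x => f x * ψ x)
      (integrable_muOmega_of_continuousOn (hf.mul hψ.smooth.continuous).continuousOn)] at h1
    linarith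
  have hDc : Continuous D := continuous_iff_continuousAt.2 fun x => (hD x).continuousAt
  obtain ⟨U, hU, hUeq⟩ := exists_ae_eq_antideriv (hdu.memLp.integrable (by norm_num)) hDc
    fun ψ hψ => by
      rw [hdu.weak ψ hψ]
      congr 1
      refine integral_congr_ae ?_
      filter_upwards [hDeq] with x hx
      rw [hx]
  have hUc : Continuous U := continuous_iff_continuousAt.2 fun x => (hU x).continuousAt
  have heq : EqOn u U Omega := Measure.eqOn_open_of_ae_eq (μ := volume) hUeq isOpen_Ioo
    (huc.mono Ioo_subset_Icc_self) hUc.continuousOn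
  refine ⟨D, fun x hx => ⟨?_, ?_⟩⟩
  · exact (hU x).congr_of_eventuallyEq (heq.eventuallyEq_of_mem (isOpen_Ioo.mem_nhds hx))
  · have := hD x
    rwa [hfeq (Ioo_subset_Icc_self hx)] at this

/-- A function of `H₀¹(Ω)` that is continuous on `[-1, 1]` vanishes at both endpoints. -/
theorem MemH10.eq_zero_of_continuousOn {v : ℝ → ℝ} (hv : MemH10 v)
    (hc : ContinuousOn v (Icc (-1) 1)) : v (-1) = 0 ∧ v 1 = 0 := by
  obtain ⟨g, hg, ψ, hψ, hlim, hlim'⟩ := hv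
  have hgi : Integrable g muOmega := hg.memLp_deriv.integrable (by norm_num)
  have hgi' : IntegrableOn g (Icc (-1) 1) := by
    rw [integrableOn_Icc_iff_integrableOn_Ioo]
    exact hgi
  have hgii : ∀ x ∈ Icc (-1 : ℝ) 1, IntervalIntegrable g volume (-1) x := fun x hx =>
    (hgi'.mono_set (by rw [uIcc_of_le hx.1]; exact Icc_subset_Icc_right hx.2)).intervalIntegrable
  -- Convergence of the derivatives in `L¹`.
  have hL1 : Tendsto (fun n => ∫ x, |deriv (ψ n) x - g x| ∂muOmega) atTop (𝓝 0) := by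
    have hmeas : ∀ n, AEStronglyMeasurable (fun x => deriv (ψ n) x - g x) muOmega := fun n =>
      (hψ n).continuous_deriv.aestronglyMeasurable.sub hgi.aestronglyMeasurable
    have hb : ∀ n, eLpNorm (fun x => deriv (ψ n) x - g x) 1 muOmega
        ≤ eLpNorm (fun x => deriv (ψ n) x - g x) 2 muOmega
          * muOmega univ ^ (1 / (1 : ENNReal).toReal - 1 / (2 : ENNReal).toReal) := fun n =>
      eLpNorm_le_eLpNorm_mul_rpow_measure_univ (by norm_num) (hmeas n)
    have hne : muOmega univ ^ (1 / (1 : ENNReal).toReal - 1 / (2 : ENNReal).toReal) ≠ ⊤ :=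
      ENNReal.rpow_ne_top_of_nonneg (by norm_num) (measure_ne_top _ _)
    have h0 := ENNReal.Tendsto.mul_const hlim' (Or.inr hne)
    rw [zero_mul] at h0
    have h1 := tendsto_of_tendsto_of_tendsto_of_le_of_le tendsto_const_nhds h0
      (fun _ => zero_le) hb
    have h2 := (ENNReal.tendsto_toReal ENNReal.zero_ne_top).comp h1
    rw [ENNReal.toReal_zero] at h2
    refine h2.congr fun n => ?_
    have := integral_norm_eq_lintegral_enorm (hmeas n)
    simp only [Real.norm_eq_abs] at this
    rw [this, Function.comp, eLpNorm_one_eq_lintegral_enorm]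
  have hprim : ∀ x ∈ Icc (-1 : ℝ) 1,
      Tendsto (fun n => ψ n x) atTop (𝓝 (∫ t in (-1 : ℝ)..x, g t)) := by
    intro x hx
    rw [tendsto_iff_norm_sub_tendsto_zero]
    refine squeeze_zero (fun _ => norm_nonneg _) (fun n => ?_) hL1
    have h1 : ψ n x = ∫ t in (-1 : ℝ)..x, deriv (ψ n) t := by
      rw [intervalIntegral.integral_eq_sub_of_hasDerivAt (fun t _ => (hψ n).hasDerivAt t)
        ((hψ n).continuous_deriv.intervalIntegrable _ _),
        (hψ n).eq_zero (x := -1) (by simp [Omega]), sub_zero]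
    rw [h1, ← intervalIntegral.integral_sub ((hψ n).continuous_deriv.intervalIntegrable _ _)
      (hgii x hx)]
    refine (intervalIntegral.norm_integral_le_integral_norm hx.1).trans ?_
    rw [integral_muOmega]
    simp only [Real.norm_eq_abs]
    refine intervalIntegral.integral_mono_interval le_rfl hx.1 hx.2
      (ae_of_all _ fun _ => abs_nonneg _) ?_
    exact (((hψ n).continuous_deriv.intervalIntegrable _ _).sub
      (hgii 1 (right_mem_Icc.2 (by norm_num)))).abs
  have hmeasure := tendstoInMeasure_of_tendsto_eLpNorm (by norm_num)
    (fun n => (hψ n).smooth.continuous.aestronglyMeasurable) hg.memLp.aestronglyMeasurable hlim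
  obtain ⟨ns, hns, hae⟩ := hmeasure.exists_seq_tendsto_ae
  have hveq : ∀ᵐ x ∂muOmega, v x = ∫ t in (-1 : ℝ)..x, g t := by
    filter_upwards [hae, ae_muOmega_of_forall fun x hx => hx] with x hx hx'
    exact tendsto_nhds_unique hx
      ((hprim x (Ioo_subset_Icc_self hx')).comp hns.tendsto_atTop)
  have hGc : ContinuousOn (fun x => ∫ t in (-1 : ℝ)..x, g t) (Icc (-1) 1) := by
    have := intervalIntegral.continuousOn_primitive_interval (μ := volume) (a := -1) (b := 1)
      (f := g) (by rwa [uIcc_of_le (by norm_num)])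
    rwa [uIcc_of_le (by norm_num)] at this
  have heq : EqOn v (fun x => ∫ t in (-1 : ℝ)..x, g t) (Icc (-1) 1) :=
    (Measure.eqOn_open_of_ae_eq (μ := volume) hveq isOpen_Ioo
      (hc.mono Ioo_subset_Icc_self) (hGc.mono Ioo_subset_Icc_self)).of_subset_closure hc hGc
      Ioo_subset_Icc_self (by rw [Omega, closure_Ioo (by norm_num)])
  have hend : ∀ x ∈ Icc (-1 : ℝ) 1, x ∉ Omega → v x = 0 := fun x hx hx' => by
    rw [heq hx]
    refine tendsto_nhds_unique (hprim x hx) ?_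
    simp only [fun n => (hψ n).eq_zero hx']
    exact tendsto_const_nhds
  exact ⟨hend _ (by simp) (by simp [Omega]), hend _ (by simp) (by simp [Omega])⟩

theorem IsWeakStep.eq_obstacle {r q h ε : ℝ} {ζ w u : ℝ → ℝ} (hu : IsWeakStep r q h ε ζ w u) :
    u (-1) = obstacle r q (-1) ∧ u 1 = obstacle r q 1 := by
  have h := hu.boundary.eq_zero_of_continuousOn
    (hu.continuousOn.sub (continuous_obstacle r q).continuousOn)
  exact ⟨sub_eq_zero.1 h.1, sub_eq_zero.1 h.2⟩

/-! ### Comparison with barriers that are maxima of smooth functions -/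

/-- `s` admits at `x` a twice differentiable lower contact function `p`, that is `p ≤ s` near `x`
with equality at `x`, whose second derivative at `x` is `κ`. -/
def HasLowerContact (s : ℝ → ℝ) (x κ : ℝ) : Prop :=
  ∃ p p' : ℝ → ℝ, (∀ y, HasDerivAt p (p' y) y) ∧ HasDerivAt p' κ x ∧ p x = s x ∧
    ∀ᶠ y in 𝓝 x, p y ≤ s y

theorem HasLowerContact.add {s t : ℝ → ℝ} {x κ l : ℝ} (hs : HasLowerContact s x κ)
    (ht : HasLowerContact t x l) : HasLowerContact (fun y => s y + t y) x (κ + l) := by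
  obtain ⟨p, p', h1, h2, h3, h4⟩ := hs
  obtain ⟨p₁, p₁', h1', h2', h3', h4'⟩ := ht
  refine ⟨fun y => p y + p₁ y, fun y => p' y + p₁' y, fun y => (h1 y).add (h1' y), h2.add h2',
    congrArg₂ (· + ·) h3 h3', ?_⟩
  filter_upwards [h4, h4'] with y hy hy'
  exact add_le_add hy hy'

theorem hasLowerContact_const (c x : ℝ) : HasLowerContact (fun _ => c) x 0 :=
  ⟨fun _ => c, fun _ => 0, fun y => hasDerivAt_const y c, hasDerivAt_const x 0, rfl,
    Eventually.of_forall fun _ => le_rfl⟩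

/-- The second derivative is nonnegative at a local minimum. -/
theorem nonneg_of_isLocalMin {f f' : ℝ → ℝ} {x κ : ℝ} (hf : ∀ᶠ y in 𝓝 x, HasDerivAt f (f' y) y)
    (hf' : HasDerivAt f' κ x) (hmin : IsLocalMin f x) : 0 ≤ κ := by
  by_contra! hneg
  have hd : deriv f =ᶠ[𝓝 x] f' := hf.mono fun y hy => hy.deriv
  have h2 : deriv (deriv f) x = κ := by rw [hd.deriv_eq, hf'.deriv]
  have hmax : IsLocalMax f x := isLocalMax_of_deriv_deriv_neg (by rw [h2]; exact hneg)
    hmin.deriv_eq_zero hf.self_of_nhds.continuousAt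
  have hconst : f =ᶠ[𝓝 x] fun _ => f x := by
    filter_upwards [hmin, hmax] with y h1 h2 using le_antisymm h2 h1
  have h3 : deriv (deriv f) x = 0 := by
    rw [hconst.deriv.deriv_eq]
    simp
  exact hneg.ne (h2.symm.trans h3)

/-- Comparison principle: if, wherever `u < s`, the function `s` has a lower contact function that
is strictly more convex than `u`, then `s ≤ u` at the endpoints propagates to the interval. -/
theorem le_of_hasLowerContact {a b : ℝ} (hab : a ≤ b) {u D f s : ℝ → ℝ}
    (hu : ContinuousOn u (Icc a b)) (hs : ContinuousOn s (Icc a b))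
    (huD : ∀ x ∈ Ioo a b, HasDerivAt u (D x) x ∧ HasDerivAt D (f x) x)
    (ha : s a ≤ u a) (hb : s b ≤ u b)
    (hcontact : ∀ x ∈ Ioo a b, u x < s x → ∃ κ, HasLowerContact s x κ ∧ f x < κ) :
    ∀ x ∈ Icc a b, s x ≤ u x := by
  obtain ⟨x, hx, hmin⟩ := isCompact_Icc.exists_isMinOn (nonempty_Icc.2 hab) (hu.sub hs)
  intro y hy
  by_contra! hlt
  have hxy : u x - s x ≤ u y - s y := hmin hy
  have hx' : x ∈ Ioo a b := by
    refine ⟨lt_of_le_of_ne hx.1 ?_, lt_of_le_of_ne hx.2 ?_⟩ <;> rintro rfl <;> linarith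
  obtain ⟨κ, ⟨p, p', h1, h2, h3, h4⟩, hκ⟩ := hcontact x hx' (by linarith)
  have hnhds : Ioo a b ∈ 𝓝 x := isOpen_Ioo.mem_nhds hx'
  have hloc : IsLocalMin (fun z => u z - p z) x := by
    filter_upwards [h4, hnhds] with z hz hz'
    have hxz : u x - s x ≤ u z - s z := hmin (Ioo_subset_Icc_self hz')
    rw [h3]
    linarith
  have := nonneg_of_isLocalMin (f' := fun z => D z - p' z)
    (by filter_upwards [hnhds] with z hz using (huD z hz).1.sub (h1 z))
    ((huD x hx').2.sub h2) hloc
  linarith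

/-! ### The obstacle and the penalty -/

/-- `-Lφ` on `(0, 1)`, where `L = -∂ₓₓ + β`; the point `log (r / q)` is its only zero. -/
noncomputable def source (r q x : ℝ) : ℝ := Real.exp (alpha r q * x) * (r - q * Real.exp x)

theorem obstacle_of_nonpos {r q x : ℝ} (hx : x ≤ 0) : obstacle r q x = 0 := by
  have : Real.exp x - 1 ≤ 0 := by linarith [Real.exp_le_one_iff.2 hx]
  rw [obstacle, max_eq_right this, mul_zero]

theorem obstacle_of_nonneg {r q x : ℝ} (hx : 0 ≤ x) :
    obstacle r q x = Real.exp ((alpha r q + 1) * x) - Real.exp (alpha r q * x) := by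
  have : 0 ≤ Real.exp x - 1 := by linarith [Real.one_le_exp hx]
  rw [obstacle, max_eq_left this, add_mul, one_mul, Real.exp_add]
  ring

theorem obstacle_nonneg (r q x : ℝ) : 0 ≤ obstacle r q x :=
  mul_nonneg (Real.exp_pos _).le (le_max_right _ _)

theorem hasLowerContact_obstacle_of_nonpos {r q x : ℝ} (hx : x ≤ 0) :
    HasLowerContact (obstacle r q) x 0 := by
  exact ⟨fun _ => 0, fun _ => 0, fun y => hasDerivAt_const y 0, hasDerivAt_const x 0,
    (obstacle_of_nonpos hx).symm, Eventually.of_forall fun y => obstacle_nonneg r q y⟩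

theorem hasDerivAt_exp_mul (a x : ℝ) :
    HasDerivAt (fun y => Real.exp (a * y)) (a * Real.exp (a * x)) x := by
  convert! ((hasDerivAt_id x).const_mul a).exp using 1
  simp [mul_comm]

theorem hasLowerContact_obstacle_of_nonneg {r q x : ℝ} (hx : 0 ≤ x) :
    HasLowerContact (obstacle r q) x (beta r q * obstacle r q x + source r q x) := by
  set a := alpha r q with ha
  refine ⟨fun y => Real.exp ((a + 1) * y) - Real.exp (a * y),
    fun y => (a + 1) * Real.exp ((a + 1) * y) - a * Real.exp (a * y),
    fun y => (hasDerivAt_exp_mul _ y).sub (hasDerivAt_exp_mul _ y), ?_,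
    (obstacle_of_nonneg hx).symm, Eventually.of_forall fun y => ?_⟩
  · convert! ((hasDerivAt_exp_mul (a + 1) x).const_mul (a + 1)).sub
      ((hasDerivAt_exp_mul a x).const_mul a) using 1
    have hq : q = r - 2 * a - 1 := by rw [ha, alpha]; ring
    have he : Real.exp ((a + 1) * x) = Real.exp (a * x) * Real.exp x := by
      rw [add_mul, one_mul, Real.exp_add]
    rw [obstacle_of_nonneg hx, source, beta, ← ha, he, hq]
    ring
  · have : Real.exp ((a + 1) * y) - Real.exp (a * y) = Real.exp (a * y) * (Real.exp y - 1) := by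
      rw [add_mul, one_mul, Real.exp_add]
      ring
    dsimp only
    rw [obstacle, ← ha, this]
    exact mul_le_mul_of_nonneg_left (le_max_left _ _) (Real.exp_pos _).le

theorem continuous_source (r q : ℝ) : Continuous (source r q) := by
  unfold source
  fun_prop

theorem source_nonneg {r q x : ℝ} (hq : 0 < q) (hr : 0 < r) (hx : x ≤ Real.log (r / q)) :
    0 ≤ source r q x := by
  have h1 : Real.exp x ≤ r / q := (Real.le_log_iff_exp_le (by positivity)).1 hx
  rw [le_div_iff₀ hq] at h1
  exact mul_nonneg (Real.exp_pos _).le (by linarith)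

theorem beta_nonneg {r q : ℝ} (hr : 0 < r) : 0 ≤ beta r q := by
  unfold beta
  positivity

theorem IsPenalty.monotone {ζ : ℝ → ℝ} (hζ : IsPenalty ζ) : Monotone ζ :=
  monotone_of_deriv_nonneg (hζ.smooth.differentiable (by simp)) hζ.deriv_nonneg

theorem IsPenalty.nonpos {ζ : ℝ → ℝ} (hζ : IsPenalty ζ) (s : ℝ) : ζ s ≤ 0 := by
  rcases le_total 0 s with h | h
  · exact (hζ.eq_zero s h).le
  · exact (hζ.monotone h).trans (hζ.eq_zero 0 le_rfl).le

/-- By concavity, a penalty function lies below a line of positive slope for negative arguments. -/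
theorem IsPenalty.exists_le {ζ : ℝ → ℝ} (hζ : IsPenalty ζ) (M : ℝ) :
    ∃ K : ℝ, 0 < K ∧ ζ (-K) ≤ M := by
  obtain ⟨s, hs⟩ := hζ.exists_neg
  have hs0 : s < 0 := by
    by_contra! h
    exact hs.ne (hζ.eq_zero s h)
  have hconc : ConcaveOn ℝ univ ζ := concaveOn_univ_of_deriv2_nonpos
    (hζ.smooth.differentiable (by simp))
    ((contDiff_infty_iff_deriv.1 hζ.smooth).2.differentiable (by simp)) hζ.deriv_deriv_nonpos
  set N := 1 + |M / ζ s| with hN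
  have hN1 : 1 ≤ N := by linarith [abs_nonneg (M / ζ s)]
  have hN0 : 0 < N := by linarith
  refine ⟨N * -s, mul_pos hN0 (by linarith), ?_⟩
  have h := hconc.2 (mem_univ (N * s)) (mem_univ (0 : ℝ)) (by positivity : 0 ≤ 1 / N)
    (by rw [sub_nonneg, div_le_one hN0]; exact hN1 : 0 ≤ 1 - 1 / N) (by ring)
  have e : (1 / N) • (N * s) + (1 - 1 / N) • (0 : ℝ) = s := by
    simp only [smul_eq_mul]
    field_simp
    ring
  rw [e, hζ.eq_zero 0 le_rfl, smul_zero, add_zero, smul_eq_mul, one_div, inv_mul_le_iff₀ hN0] at h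
  have h2 : M / ζ s ≤ N := by linarith [le_abs_self (M / ζ s)]
  rw [div_le_iff_of_neg hs] at h2
  have h3 : -(N * -s) = N * s := by ring
  rw [h3]
  linarith

/-! ### One time step -/

section Step

variable {r q h ε : ℝ} {ζ w u : ℝ → ℝ}

/-- The obstacle is violated by at most a multiple of the penalization parameter, and this bound
passes from one step to the next. -/
theorem IsWeakStep.obstacle_sub_le (hu : IsWeakStep r q h ε ζ w u) (hr : 0 < r) (hh : 0 < h)
    (hε : 0 < ε) (hζ : IsPenalty ζ) (hw : ContinuousOn w (Icc (-1) 1)) {K : ℝ} (hK : 0 ≤ K)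
    (hKs : ∀ x ∈ Icc (0 : ℝ) 1, ζ (-K) ≤ source r q x)
    (hwK : ∀ x ∈ Icc (-1 : ℝ) 1, obstacle r q x - K * ε ≤ w x) :
    ∀ x ∈ Icc (-1 : ℝ) 1, obstacle r q x - K * ε ≤ u x := by
  obtain ⟨D, hD⟩ := hu.exists_hasDerivAt hw hζ.smooth.continuous
  have hKε : 0 ≤ K * ε := by positivity
  have hβ := beta_nonneg (q := q) hr
  refine le_of_hasLowerContact (by norm_num) hu.continuousOn
    ((continuous_obstacle r q).sub continuous_const).continuousOn hD
    (by linarith [hu.eq_obstacle.1]) (by linarith [hu.eq_obstacle.2]) fun x hx hlt => ?_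
  have h1 : (u x - w x) / h < 0 :=
    div_neg_of_neg_of_pos (by linarith [hwK x (Ioo_subset_Icc_self hx)]) hh
  have h2 : beta r q * u x ≤ beta r q * obstacle r q x :=
    mul_le_mul_of_nonneg_left (by linarith) hβ
  have h3 : ζ ((u x - obstacle r q x) / ε) ≤ ζ (-K) :=
    hζ.monotone ((div_le_iff₀ hε).2 (by linarith))
  rcases le_total x 0 with hx0 | hx0
  · refine ⟨0 + 0, (hasLowerContact_obstacle_of_nonpos hx0).add
      (hasLowerContact_const (-(K * ε)) x), ?_⟩
    rw [obstacle_of_nonpos hx0, mul_zero] at h2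
    linarith [hζ.nonpos (-K)]
  · refine ⟨_ + 0, (hasLowerContact_obstacle_of_nonneg hx0).add
      (hasLowerContact_const (-(K * ε)) x), ?_⟩
    linarith [hKs x ⟨hx0, hx.2.le⟩]

/-- Comparison of one step with `φ + S`. The penalization is dropped, as it has the right sign. -/
theorem IsWeakStep.obstacle_add_le (hu : IsWeakStep r q h ε ζ w u) (hr : 0 < r) (hh : 0 < h)
    (hζ : IsPenalty ζ) (hw : ContinuousOn w (Icc (-1) 1)) {b : ℝ} (hb : -1 ≤ b) (hb1 : b ≤ 1)
    {S : ℝ → ℝ} (hS : Continuous S) (hSl : S (-1) ≤ 0) (hSr : obstacle r q b + S b ≤ u b)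
    (hcontact : ∀ x ∈ Ioo (-1) b, ∃ κ, HasLowerContact S x κ ∧
      (x ≤ 0 → (1 / h + beta r q) * S x ≤ κ + (w x - obstacle r q x) / h) ∧
      (0 ≤ x → (1 / h + beta r q) * S x ≤
        κ + source r q x + (w x - obstacle r q x) / h)) :
    ∀ x ∈ Icc (-1) b, obstacle r q x + S x ≤ u x := by
  obtain ⟨D, hD⟩ := hu.exists_hasDerivAt hw hζ.smooth.continuous
  have hβ := beta_nonneg (q := q) hr
  refine le_of_hasLowerContact hb (hu.continuousOn.mono (Icc_subset_Icc_right hb1))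
    ((continuous_obstacle r q).add hS).continuousOn
    (fun x hx => hD x ⟨hx.1, hx.2.trans_le hb1⟩)
    (by linarith [hu.eq_obstacle.1]) hSr fun x hx hlt => ?_
  obtain ⟨κ, hκ, hn, hp⟩ := hcontact x hx
  have h1 : (u x - w x) / h < (obstacle r q x + S x - w x) / h :=
    div_lt_div_of_pos_right (by linarith) hh
  have h2 : beta r q * u x ≤ beta r q * (obstacle r q x + S x) :=
    mul_le_mul_of_nonneg_left hlt.le hβ
  have h3 := hζ.nonpos ((u x - obstacle r q x) / ε)
  have e : (obstacle r q x + S x - w x) / h = 1 / h * S x - (w x - obstacle r q x) / h := by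
    ring
  rcases le_total x 0 with hx0 | hx0
  · refine ⟨0 + κ, (hasLowerContact_obstacle_of_nonpos hx0).add hκ, ?_⟩
    have := hn hx0
    rw [obstacle_of_nonpos hx0] at *
    linarith
  · refine ⟨_ + κ, (hasLowerContact_obstacle_of_nonneg hx0).add hκ, ?_⟩
    linarith [hp hx0]

end Step

/-! ### The barrier -/

theorem exp_le_one_add_add_sq (s : ℝ) : Real.exp s ≤ 1 + s + s ^ 2 * Real.exp |s| := by
  have h1 : Real.exp s - 1 ≤ s * Real.exp s := by
    have := Real.add_one_le_exp (-s)
    rw [Real.exp_neg, ← one_div, le_div_iff₀ (Real.exp_pos s)] at this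
    linarith
  have h2 := Real.add_one_le_exp s
  rcases le_total 0 s with hs | hs
  · rw [abs_of_nonneg hs]
    nlinarith
  · have h3 : 1 ≤ Real.exp |s| := Real.one_le_exp (abs_nonneg s)
    nlinarith [sq_nonneg s]

/-- Quadratic lower bound for `-Lφ` at its zero. The constant is taken so large that the quadratic
is negative for `x ≤ 0`. -/
theorem exists_source_ge {r q : ℝ} (hq : 0 < q) (hqr : q < r) :
    ∃ C : ℝ, 0 < C ∧
      2 * (r * Real.exp (alpha r q * Real.log (r / q))) ≤ C * Real.log (r / q) ∧
      ∀ t : ℝ, |t| ≤ 1 → -(r * Real.exp (alpha r q * Real.log (r / q))) * t - C * t ^ 2 ≤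
        source r q (Real.log (r / q) + t) := by
  have hr : 0 < r := hq.trans hqr
  set x₀ := Real.log (r / q) with hx₀
  have hx₀pos : 0 < x₀ := Real.log_pos ((one_lt_div hq).2 hqr)
  set a := alpha r q with ha
  set c := r * Real.exp (a * x₀) with hc
  have hcpos : 0 < c := by positivity
  set B := (a + 1) ^ 2 * Real.exp |a + 1| with hB
  have hB0 : 0 ≤ B := by positivity
  refine ⟨2 * c / x₀ + c * B, by positivity, ?_, fun t ht => ?_⟩
  · rw [add_mul, div_mul_cancel₀ _ hx₀pos.ne']
    have : 0 ≤ c * B * x₀ := by positivity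
    linarith
  have hexp : q * Real.exp x₀ = r := by
    rw [hx₀, Real.exp_log (by positivity)]
    field_simp
  have hs : source r q (x₀ + t) = c * (Real.exp (a * t) - Real.exp ((a + 1) * t)) := by
    rw [source, ← ha, mul_add, Real.exp_add, Real.exp_add, ← mul_assoc q, hexp, add_mul, one_mul,
      Real.exp_add, hc]
    ring
  have h1 := Real.add_one_le_exp (a * t)
  have h2 := exp_le_one_add_add_sq ((a + 1) * t)
  have h3 : ((a + 1) * t) ^ 2 * Real.exp |(a + 1) * t| ≤ B * t ^ 2 := by
    have : Real.exp |(a + 1) * t| ≤ Real.exp |a + 1| := by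
      rw [abs_mul]
      exact Real.exp_le_exp.2 (mul_le_of_le_one_right (abs_nonneg _) ht)
    rw [mul_pow, hB]
    nlinarith [mul_le_mul_of_nonneg_left this (by positivity : 0 ≤ (a + 1) ^ 2 * t ^ 2)]
  have h4 : -t - B * t ^ 2 ≤ Real.exp (a * t) - Real.exp ((a + 1) * t) := by linarith
  have h5 : 0 ≤ 2 * c / x₀ * t ^ 2 := by positivity
  rw [hs]
  nlinarith [mul_le_mul_of_nonneg_left h4 hcpos.le]

/-- The barrier near the point `x₀` where `-Lφ` changes sign, in the variable `t = x - x₀`: the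
solution `k³ c (e^y / 3 - y)` of the rescaled linear problem, with `k = √h` and `y = t / k`,
corrected at the next order. -/
noncomputable def profile (c C E k t : ℝ) : ℝ :=
  k ^ 2 * (-c * t - C * t ^ 2 - E * k ^ 2) + c * k ^ 3 / 3 * Real.exp (t / k)

section Profile

variable {c C E k t : ℝ}

theorem continuous_profile (c C E k : ℝ) : Continuous (profile c C E k) := by
  unfold profile
  fun_prop

/-- `c` is the rate at which `-Lφ` decreases; `e ^ (1/2) / 3 > 1/2` makes the profile positive up
to `y = 1/2`. -/
theorem profile_pos (hc : 0 < c) (hC : 0 < C) (hk : 0 < k)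
    (hkc : (C + E) * k < c / 24) (ht0 : 0 ≤ t) (htk : t ≤ k / 2) : 0 < profile c C E k t := by
  obtain ⟨y, rfl⟩ : ∃ y, t = k * y := ⟨t / k, by field_simp⟩
  have hy0 : 0 ≤ y := nonneg_of_mul_nonneg_right ht0 hk
  have hy1 : y ≤ 1 / 2 := by
    by_contra! hlt
    nlinarith
  have he := Real.quadratic_le_exp_of_nonneg hy0
  have h1 : 1 / 24 ≤ Real.exp y / 3 - y := by nlinarith
  have h2 : c / 24 ≤ c * (Real.exp y / 3 - y) := by nlinarith
  have h3 : C * k * y ^ 2 ≤ C * k := mul_le_of_le_one_right (by positivity) (by nlinarith)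
  have e : profile c C E k (k * y)
      = k ^ 3 * (c * (Real.exp y / 3 - y) - C * k * y ^ 2 - E * k) := by
    rw [profile, mul_div_cancel_left₀ _ hk.ne']
    ring
  rw [e]
  exact mul_pos (by positivity) (by linarith)

/-- At `y = 1` the profile is negative because `e < 3`. -/
theorem profile_self_le (hc : 0 < c) (hC : 0 < C) (hk : 0 < k) :
    profile c C E k k ≤ -(E * k ^ 4) := by
  have he := Real.exp_one_lt_d9
  rw [profile, div_self hk.ne']
  have h1 : c * k ^ 3 / 3 * Real.exp 1 ≤ c * k ^ 3 / 3 * 3 :=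
    mul_le_mul_of_nonneg_left (by linarith) (by positivity)
  have h2 : 0 ≤ C * k ^ 4 := by positivity
  nlinarith

theorem profile_neg {x₀ : ℝ} (hc : 0 < c) (hE : 0 ≤ E) (hk : 0 < k) (hx₀ : k < x₀)
    (hC : 2 * c ≤ C * x₀) (ht : t ≤ -x₀) : profile c C E k t < 0 := by
  have hx₀0 : 0 < x₀ := hk.trans hx₀
  have hC0 : 0 < C := by
    by_contra! hle
    nlinarith
  have he : Real.exp (t / k) ≤ 1 :=
    Real.exp_le_one_iff.2 (div_nonpos_of_nonpos_of_nonneg (by linarith) hk.le)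
  have h1 : c + C * t ≤ -c := by nlinarith
  have h2 : -c * t - C * t ^ 2 ≤ -(c * x₀) := by nlinarith
  have h3 : c * k ^ 3 / 3 * Real.exp (t / k) ≤ c * k ^ 3 / 3 :=
    mul_le_of_le_one_right (by positivity) he
  have h4 : k ^ 2 * (-c * t - C * t ^ 2 - E * k ^ 2) ≤ k ^ 2 * -(c * x₀) :=
    mul_le_mul_of_nonneg_left (by nlinarith [mul_nonneg hE (sq_nonneg k)]) (by positivity)
  have h5 : 0 < c * k ^ 2 * (x₀ - k / 3) := mul_pos (by positivity) (by linarith)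
  rw [profile]
  nlinarith

theorem profile_le (hc : 0 < c) (hC : 0 < C) (hE : 0 ≤ E) (hk : 0 < k) (hk1 : k ≤ 1)
    (ht : -1 ≤ t) (htk : t ≤ k) : profile c C E k t ≤ 2 * c * k ^ 2 := by
  have he : Real.exp (t / k) ≤ 3 :=
    (Real.exp_le_exp.2 ((div_le_one hk).2 htk)).trans (by linarith [Real.exp_one_lt_d9])
  have h1 : c * k ^ 3 / 3 * Real.exp (t / k) ≤ c * k ^ 3 / 3 * 3 :=
    mul_le_mul_of_nonneg_left he (by positivity)
  have h2 : c * k ^ 3 ≤ c * k ^ 2 :=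
    mul_le_mul_of_nonneg_left (pow_le_pow_of_le_one hk.le hk1 (by norm_num)) hc.le
  have h3 : k ^ 2 * (-c * t - C * t ^ 2 - E * k ^ 2) ≤ k ^ 2 * c := by
    refine mul_le_mul_of_nonneg_left ?_ (by positivity)
    nlinarith [mul_nonneg hE (sq_nonneg k), mul_nonneg hC.le (sq_nonneg t)]
  rw [profile]
  linarith

theorem hasDerivAt_profile (hk : 0 < k) (t : ℝ) : HasDerivAt (profile c C E k)
    (k ^ 2 * (-c - 2 * C * t) + c * k ^ 2 / 3 * Real.exp (t / k)) t := by
  have h1 : HasDerivAt (fun t => Real.exp (t / k)) (Real.exp (t / k) * (1 / k)) t :=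
    ((hasDerivAt_id t).div_const k).exp
  have h2 : HasDerivAt (fun t : ℝ => -c * t - C * t ^ 2 - E * k ^ 2) (-c - 2 * C * t) t := by
    convert! ((((hasDerivAt_id t).const_mul (-c)).sub
      (((hasDerivAt_id t).pow 2).const_mul C)).sub_const (E * k ^ 2)) using 1
    simp
    ring
  convert! (h2.const_mul (k ^ 2)).add (h1.const_mul (c * k ^ 3 / 3)) using 1
  field_simp

theorem hasDerivAt_deriv_profile (hk : 0 < k) (t : ℝ) :
    HasDerivAt (fun t => k ^ 2 * (-c - 2 * C * t) + c * k ^ 2 / 3 * Real.exp (t / k))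
      (-2 * C * k ^ 2 + c * k / 3 * Real.exp (t / k)) t := by
  have h1 : HasDerivAt (fun t => Real.exp (t / k)) (Real.exp (t / k) * (1 / k)) t :=
    ((hasDerivAt_id t).div_const k).exp
  have h2 : HasDerivAt (fun t : ℝ => -c - 2 * C * t) (-2 * C) t := by
    convert! ((hasDerivAt_id t).const_mul (2 * C)).const_sub (-c) using 1
    ring
  convert! (h2.const_mul (k ^ 2)).add (h1.const_mul (c * k ^ 2 / 3)) using 1
  field_simp

/-- The profile is a subsolution with right-hand side `-c t - C t²`, with room for the error `K k⁶`
caused by the penalization of the preceding step. -/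
theorem profile_subsolution {β K : ℝ} (hc : 0 < c) (hC : 0 < C) (hβ : 0 ≤ β) (hK : 0 ≤ K)
    (hE : E = 2 * C + 2 * β * c + K) (hk : 0 < k) (hk1 : k ≤ 1) (ht : -1 ≤ t) (htk : t ≤ k) :
    (1 / k ^ 2 + β) * profile c C E k t + K * k ^ 6 ≤
      -2 * C * k ^ 2 + c * k / 3 * Real.exp (t / k) + (-c * t - C * t ^ 2) := by
  have hE0 : 0 ≤ E := by rw [hE]; positivity
  have h1 := mul_le_mul_of_nonneg_left (profile_le hc hC hE0 hk hk1 ht htk) hβ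
  have h2 : K * k ^ 6 ≤ K * k ^ 2 :=
    mul_le_mul_of_nonneg_left (pow_le_pow_of_le_one hk.le hk1 (by norm_num)) hK
  have e : 1 / k ^ 2 * profile c C E k t
      = -c * t - C * t ^ 2 - E * k ^ 2 + c * k / 3 * Real.exp (t / k) := by
    rw [profile]
    field_simp
  rw [add_mul, e]
  have : E * k ^ 2 = 2 * C * k ^ 2 + 2 * β * c * k ^ 2 + K * k ^ 2 := by rw [hE]; ring
  linarith

end Profile

/-- The barrier on `[-1, x₀ + k]`, where `k = √h`. To the left of `x₀` it is the maximum of the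
profile and a small multiple of `exp (l (x + 1)) - 1`, whose positivity carries that of the barrier
to the left endpoint. With `ε < h ^ 4 = k ^ 8`, the bound `K k ^ 8` at the right endpoint covers the
violation `K ε` of the obstacle there, and `K k ^ 6` covers the contribution `K ε / h` of the
preceding step. -/
theorem exists_barrier {r q : ℝ} (hq : 0 < q) (hqr : q < r) (hre : r < q * Real.exp 1) {K : ℝ}
    (hK : 0 < K) :
    ∃ k₀ : ℝ, 0 < k₀ ∧ ∀ k : ℝ, 0 < k → k < k₀ → Real.log (r / q) + k < 1 ∧
      ∃ S : ℝ → ℝ, Continuous S ∧ S (-1) ≤ 0 ∧ S (Real.log (r / q) + k) ≤ -(K * k ^ 8) ∧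
        (∀ x, -1 < x → x ≤ Real.log (r / q) + k / 2 → 0 < S x) ∧
        ∀ x ∈ Ioo (-1) (Real.log (r / q) + k), ∃ κ, HasLowerContact S x κ ∧
          ((x < Real.log (r / q) ∧ (1 / k ^ 2 + beta r q) * S x ≤ κ) ∨
            (0 < x ∧ (1 / k ^ 2 + beta r q) * S x + K * k ^ 6 ≤ κ + source r q x)) := by
  have hr : 0 < r := hq.trans hqr
  have hβ := beta_nonneg (q := q) hr
  obtain ⟨C, hC, hCx, hsource⟩ := exists_source_ge hq hqr
  set x₀ := Real.log (r / q) with hx₀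
  have hx₀pos : 0 < x₀ := Real.log_pos ((one_lt_div hq).2 hqr)
  have hx₀1 : x₀ < 1 := by
    rw [hx₀, Real.log_lt_iff_lt_exp (by positivity), div_lt_iff₀ hq]
    linarith
  set c := r * Real.exp (alpha r q * x₀) with hc
  have hcpos : 0 < c := by positivity
  set E := 2 * C + 2 * beta r q * c + K with hE
  have hEK : K ≤ E := by
    have : 0 ≤ 2 * beta r q * c := by positivity
    linarith
  have hEpos : 0 < E := hK.trans_le hEK
  refine ⟨min (min 1 (1 - x₀)) (min x₀ (c / 24 / (C + E))),
    lt_min (lt_min one_pos (by linarith)) (lt_min hx₀pos (by positivity)), fun k hk hkk => ?_⟩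
  have hk1 : k < 1 := hkk.trans_le ((min_le_left _ _).trans (min_le_left _ _))
  have hkx : k < 1 - x₀ := hkk.trans_le ((min_le_left _ _).trans (min_le_right _ _))
  have hkx₀ : k < x₀ := hkk.trans_le ((min_le_right _ _).trans (min_le_left _ _))
  have hkc : (C + E) * k < c / 24 := by
    have := hkk.trans_le ((min_le_right _ _).trans (min_le_right _ _))
    rw [lt_div_iff₀ (by positivity)] at this
    linarith
  refine ⟨by linarith, ?_⟩
  set P : ℝ → ℝ := fun x => profile c C E k (x - x₀) with hP
  have hPc : Continuous P := (continuous_profile c C E k).comp (by fun_prop)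
  have hP₀ : 0 < P x₀ := profile_pos hcpos hC hk hkc (by linarith) (by linarith)
  set L := 1 / k ^ 2 + beta r q with hL
  have hLpos : 0 < L := by positivity
  set l := √L with hl
  have hll : l * l = L := Real.mul_self_sqrt hLpos.le
  have hlpos : 0 < l := Real.sqrt_pos.2 hLpos
  set A := P x₀ / Real.exp (l * (x₀ + 1)) with hA
  have hApos : 0 < A := by positivity
  set Q : ℝ → ℝ := fun x => A * (Real.exp (l * (x + 1)) - 1) with hQ
  have hQc : Continuous Q := by fun_prop
  have hQ₀ : Q x₀ < P x₀ := by
    have : A * Real.exp (l * (x₀ + 1)) = P x₀ := div_mul_cancel₀ _ (Real.exp_pos _).ne'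
    simp only [hQ]
    linarith
  have hQneg : Q (-1) = 0 := by simp [hQ]
  have hQpos : ∀ x, -1 < x → 0 < Q x := fun x hx => by
    have : 1 < Real.exp (l * (x + 1)) := Real.one_lt_exp_iff.2 (mul_pos hlpos (by linarith))
    exact mul_pos hApos (by linarith)
  have hPneg : ∀ x ≤ 0, P x < 0 := fun x hx =>
    profile_neg hcpos hEpos.le hk hkx₀ hCx (by linarith)
  refine ⟨fun x => if x ≤ x₀ then max (Q x) (P x) else P x, ?_, ?_, ?_, ?_, ?_⟩
  · refine (hQc.max hPc).if_le hPc continuous_id continuous_const ?_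
    rintro x rfl
    exact max_eq_right hQ₀.le
  · dsimp only
    rw [if_pos (by linarith), hQneg]
    exact max_le le_rfl (hPneg _ (by norm_num)).le
  · dsimp only
    rw [if_neg (by linarith)]
    simp only [hP, add_sub_cancel_left]
    refine (profile_self_le hcpos hC hk).trans (neg_le_neg ?_)
    exact mul_le_mul hEK (pow_le_pow_of_le_one hk.le hk1.le (by norm_num)) (by positivity)
      hEpos.le
  · intro x hx hx'
    dsimp only
    split_ifs with hxx
    · exact lt_max_of_lt_left (hQpos x hx)
    · exact profile_pos hcpos hC hk hkc (by linarith) (by linarith)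
  · intro x hx
    -- Away from the exponential piece, the profile itself touches the barrier.
    have hcase : 0 < x → (if x ≤ x₀ then max (Q x) (P x) else P x) = P x →
        ∃ κ, HasLowerContact (fun x => if x ≤ x₀ then max (Q x) (P x) else P x) x κ ∧
          ((x < x₀ ∧ L * (if x ≤ x₀ then max (Q x) (P x) else P x) ≤ κ) ∨
            (0 < x ∧ L * (if x ≤ x₀ then max (Q x) (P x) else P x) + K * k ^ 6 ≤
              κ + source r q x)) := by
      intro hx0 hSP
      refine ⟨-2 * C * k ^ 2 + c * k / 3 * Real.exp ((x - x₀) / k), ⟨P, _, fun y =>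
        (hasDerivAt_profile hk (y - x₀)).comp_sub_const y x₀,
        (hasDerivAt_deriv_profile hk (x - x₀)).comp_sub_const x x₀, hSP.symm,
        Eventually.of_forall fun y => ?_⟩, Or.inr ⟨hx0, ?_⟩⟩
      · dsimp only
        split_ifs
        · exact le_max_right _ _
        · exact le_rfl
      · rw [hSP]
        have h1 := profile_subsolution hcpos hC hβ hK.le hE hk hk1.le
          (t := x - x₀) (by linarith) (by linarith [hx.2])
        have h2 := hsource (x - x₀) (abs_le.2 ⟨by linarith, by linarith [hx.2]⟩)
        rw [add_sub_cancel] at h2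
        simp only [hP]
        linarith
    rcases lt_or_ge x x₀ with hlt | hge
    · rcases le_or_gt (P x) (Q x) with hPQ | hPQ
      · have hSQ : (if x ≤ x₀ then max (Q x) (P x) else P x) = Q x := by
          rw [if_pos hlt.le, max_eq_left hPQ]
        have hd : ∀ y, HasDerivAt (fun y => Real.exp (l * (y + 1)))
            (l * Real.exp (l * (y + 1))) y := fun y =>
          (hasDerivAt_exp_mul l (y + 1)).comp_add_const y 1
        refine ⟨A * (l * (l * Real.exp (l * (x + 1)))), ⟨Q,
          fun y => A * (l * Real.exp (l * (y + 1))), fun y => ((hd y).sub_const 1).const_mul A,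
          ((hd x).const_mul l).const_mul A, hSQ.symm, ?_⟩, Or.inl ⟨hlt, ?_⟩⟩
        · filter_upwards [Iio_mem_nhds hlt] with y hy
          rw [if_pos (le_of_lt hy)]
          exact le_max_left _ _
        · dsimp only
          rw [hSQ, ← mul_assoc l, hll]
          have : 0 < L * A := by positivity
          simp only [hQ]
          linarith
      · have hx0 : 0 < x := by
          by_contra! hle
          linarith [hPneg x hle, hQpos x hx.1]
        exact hcase hx0 (by rw [if_pos hlt.le, max_eq_right hPQ.le])
    · refine hcase (by linarith) ?_
      rcases hge.eq_or_lt with rfl | hgt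
      · rw [if_pos le_rfl, max_eq_right hQ₀.le]
      · rw [if_neg (not_le.2 hgt)]

end DMS

/-! ### Iteration -/

theorem theorem4p5 (r q T : ℝ) (hT : 0 < T) (hq : 0 < q) (hqr : q < r) (hre : r < q * Real.exp 1)
    (ζ : ℝ → ℝ) (hζ : DMS.IsPenalty ζ) :
    ∃ h₂ : ℝ, 0 < h₂ ∧ ∀ h : ℝ, 0 < h → h < h₂ → ∀ ε : ℝ, 0 < ε → ε < h ^ 4 →
      ∀ u : ℕ → ℝ → ℝ, DMS.IsPenalizedDMS r q T h ε ζ u →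
        ∀ m : ℕ, 1 ≤ m → m ≤ ⌊T / h⌋₊ →
          ∀ x : ℝ, -1 < x → x < Real.log (r / q) + Real.sqrt h / 2 →
            x < 1 ∧ DMS.obstacle r q x < u m x := by
  open DMS in
  have hr : 0 < r := hq.trans hqr
  obtain ⟨M, hM⟩ := (isCompact_Icc (a := (0 : ℝ)) (b := 1)).bddBelow_image
    (continuous_source r q).continuousOn
  obtain ⟨K, hK, hKM⟩ := hζ.exists_le M
  have hKs : ∀ x ∈ Icc (0 : ℝ) 1, ζ (-K) ≤ source r q x := fun x hx =>
    hKM.trans (hM (mem_image_of_mem _ hx))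
  obtain ⟨k₀, hk₀, hbarrier⟩ := exists_barrier hq hqr hre hK
  refine ⟨k₀ ^ 2, by positivity, fun h hh hhk ε hε hεh u hu => ?_⟩
  set k := √h with hk
  have hkpos : 0 < k := Real.sqrt_pos.2 hh
  have hkh : k ^ 2 = h := Real.sq_sqrt hh.le
  obtain ⟨hb1, S, hSc, hSl, hSr, hSpos, hS⟩ := hbarrier k hkpos
    (by rw [hk, Real.sqrt_lt' hk₀]; exact hhk)
  set x₀ := Real.log (r / q) with hx₀
  have hx₀pos : 0 < x₀ := Real.log_pos ((one_lt_div hq).2 hqr)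
  have hKε : K * ε ≤ K * k ^ 8 := by
    refine mul_le_mul_of_nonneg_left ?_ hK.le
    rw [show k ^ 8 = (k ^ 2) ^ 4 by ring, hkh]
    exact hεh.le
  -- The bounds from below that pass from each step to the next.
  have key : ∀ n : ℕ, n ≤ ⌊T / h⌋₊ → ContinuousOn (u n) (Icc (-1) 1) ∧
      (∀ x ∈ Icc (-1 : ℝ) 1, obstacle r q x - K * ε ≤ u n x) ∧
      (∀ x ∈ Icc (-1) (x₀ + k / 2), obstacle r q x ≤ u n x) ∧
      (1 ≤ n → ∀ x, -1 < x → x < x₀ + k / 2 → obstacle r q x < u n x) := by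
    intro n
    induction n with
    | zero =>
      intro _
      refine ⟨(continuous_obstacle r q).continuousOn.congr hu.init, fun x hx => ?_, fun x hx => ?_,
        fun h => absurd h (by norm_num)⟩
      · rw [hu.init hx]
        linarith [mul_pos hK hε]
      · rw [hu.init ⟨hx.1, by linarith [hx.2]⟩]
    | succ n ih =>
      intro hn
      obtain ⟨hwc, hwK, hw0, -⟩ := ih (by omega)
      have hstep : IsWeakStep r q h ε ζ (u n) (u (n + 1)) := hu.step (n + 1) (by omega) hn
      have huK := hstep.obstacle_sub_le hr hh hε hζ hwc hK.le hKs hwK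
      have huS := hstep.obstacle_add_le hr hh hζ hwc (b := x₀ + k) (by linarith) hb1.le hSc hSl
        (by linarith [huK (x₀ + k) ⟨by linarith, hb1.le⟩]) fun x hx => by
          obtain ⟨κ, hκ, h1 | h1⟩ := hS x hx
          · rw [hkh] at h1
            have hwx : 0 ≤ (u n x - obstacle r q x) / h :=
              div_nonneg (sub_nonneg.2 (hw0 x ⟨hx.1.le, by linarith [h1.1]⟩)) hh.le
            exact ⟨κ, hκ, fun _ => by linarith [h1.2],
              fun _ => by linarith [h1.2, source_nonneg hq hr h1.1.le]⟩
          · rw [hkh] at h1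
            have hwx : -(K * k ^ 6) ≤ (u n x - obstacle r q x) / h := by
              rw [le_div_iff₀ hh, ← hkh]
              linarith [hwK x ⟨hx.1.le, by linarith [hx.2]⟩]
            exact ⟨κ, hκ, fun hx0 => absurd h1.1 (not_lt.2 hx0), fun _ => by linarith [h1.2]⟩
      have hpos : ∀ x, -1 < x → x ≤ x₀ + k / 2 → obstacle r q x < u (n + 1) x :=
        fun x hx hx' => by linarith [huS x ⟨hx.le, by linarith⟩, hSpos x hx hx']
      refine ⟨hstep.continuousOn, huK, fun x hx => ?_, fun _ x hx hx' => hpos x hx hx'.le⟩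
      rcases hx.1.eq_or_lt with rfl | hlt
      · exact hstep.eq_obstacle.1.ge
      · exact (hpos x hlt hx.2).le
  intro m hm hmT x hx hx'
  exact ⟨by linarith, (key m hmT).2.2.2 hm x hx hx'⟩
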